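/- Let $H$ be a complex Hilbert space and let $A$ be a non-zero positive bounded linear operator on $H$. Put $\langle x,y\rangle_A=\langle Ax,y\rangle$ and $\|x\|_A=\langle x,x\rangle_A^{1/2}=\|A^{1/2}x\|$ for $x,y\in H$. Let $\mathcal B_A(H)$ be the set of all bounded linear operators $T$ on $H$ that admit an $A$-adjoint, that is, for which there is a bounded linear operator $W$ on $H$ with $\langle Tx,y\rangle_A=\langle x,Wy\rangle_A$ for all $x,y\in H$. For $T\in\mathcal B_A(H)$ define $$\|T\|_A=\sup\{\|Tx\|_A : x\in H,\ \|x\|_A=1\},\qquad \omega_A(T)=\sup\{|\langle Tx,x\rangle_A| : x\in H,\ \|x\|_A=1\};$$ both suprema are finite. Then for all $T,S\in\mathcal B_A(H)$, $$\omega_A(TS)\le \tfrac12\,\omega_A(ST)+\tfrac14\big(\|T\|_A\|S\|_A+\|TS\|_A\big).$$ -/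

import Mathlib

namespace SemiHilbert

variable {H : Type*} [NormedAddCommGroup H] [InnerProductSpace ℂ H]

/-- The semi-inner product `⟨x, y⟩_A = ⟨A x, y⟩` induced by an operator `A`
(meant for positive `A`). -/
noncomputable def aInner (A : H →L[ℂ] H) (x y : H) : ℂ :=
  @inner ℂ H InnerProductSpace.toInner (A x) y

/-- The seminorm `‖x‖_A = √⟨x, x⟩_A` induced by the semi-inner product. For positive `A` it equals
`‖A^{1/2} x‖`, see `aNorm_eq_norm_sqrt`. -/
noncomputable def aNorm (A : H →L[ℂ] H) (x : H) : ℝ := Real.sqrt (aInner A x x).re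

/-- `W` is an `A`-adjoint of `T`: `⟨T x, y⟩_A = ⟨x, W y⟩_A` for all `x`, `y`. -/
def IsAAdjoint (A T W : H →L[ℂ] H) : Prop :=
  ∀ x y : H, aInner A (T x) y = aInner A x (W y)

/-- `B_A(H)`: the set of all bounded operators on `H` that admit a (bounded) `A`-adjoint. -/
def BA (A : H →L[ℂ] H) : Set (H →L[ℂ] H) := {T | ∃ W : H →L[ℂ] H, IsAAdjoint A T W}

/-- The `A`-operator seminorm `‖T‖_A = sup {‖T x‖_A : ‖x‖_A = 1}`. It is a supremum of reals; the
set is bounded above for every `T` in `B_A(H)`, see `bddAbove_opANorm`. -/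
noncomputable def opANorm (A T : H →L[ℂ] H) : ℝ :=
  sSup {r : ℝ | ∃ x : H, aNorm A x = 1 ∧ r = aNorm A (T x)}

/-- The `A`-numerical radius `ω_A(T) = sup {|⟨T x, x⟩_A| : ‖x‖_A = 1}`. It is a supremum of reals;
the set is bounded above for every `T` in `B_A(H)`, see `bddAbove_aNumericalRadius`. -/
noncomputable def aNumericalRadius (A T : H →L[ℂ] H) : ℝ :=
  sSup {r : ℝ | ∃ x : H, aNorm A x = 1 ∧ r = ‖aInner A (T x) x‖}

/-- `B_A(H)` is closed under products. -/
theorem comp_mem_BA {A T S : H →L[ℂ] H} (hT : T ∈ BA A) (hS : S ∈ BA A) : T ∘L S ∈ BA A := by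
  obtain ⟨V, hV⟩ := hT
  obtain ⟨W, hW⟩ := hS
  exact ⟨W ∘L V, fun x y => (hV (S x) y).trans (hW x (V y))⟩

section Complete

variable [CompleteSpace H]

theorem aInner_eq_inner_sqrt {A : H →L[ℂ] H} (hA : A.IsPositive) (x y : H) :
    aInner A x y = @inner ℂ H InnerProductSpace.toInner (CFC.sqrt A x) (CFC.sqrt A y) := by
  have h0 : 0 ≤ A := (ContinuousLinearMap.nonneg_iff_isPositive A).2 hA
  have h1 : CFC.sqrt A * CFC.sqrt A = A := CFC.sqrt_mul_sqrt_self A h0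
  have h2 : (CFC.sqrt A).IsPositive :=
    (ContinuousLinearMap.nonneg_iff_isPositive _).1 (CFC.sqrt_nonneg A)
  calc aInner A x y = @inner ℂ H InnerProductSpace.toInner ((CFC.sqrt A * CFC.sqrt A) x) y := by rw [h1]; rfl
    _ = @inner ℂ H InnerProductSpace.toInner (CFC.sqrt A x) (CFC.sqrt A y) := h2.isSymmetric (CFC.sqrt A x) y

theorem aNorm_eq_norm_sqrt {A : H →L[ℂ] H} (hA : A.IsPositive) (x : H) :
    aNorm A x = ‖CFC.sqrt A x‖ := by
  rw [aNorm, aInner_eq_inner_sqrt hA, inner_self_eq_norm_sq_to_K]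
  norm_cast
  exact Real.sqrt_sq (norm_nonneg _)

theorem norm_aInner_le {A : H →L[ℂ] H} (hA : A.IsPositive) (x y : H) :
    ‖aInner A x y‖ ≤ aNorm A x * aNorm A y := by
  rw [aInner_eq_inner_sqrt hA, aNorm_eq_norm_sqrt hA, aNorm_eq_norm_sqrt hA]
  exact norm_inner_le_norm _ _

theorem aNorm_sq {A : H →L[ℂ] H} (hA : A.IsPositive) (x : H) :
    aNorm A x ^ 2 = ‖aInner A x x‖ := by
  rw [aInner_eq_inner_sqrt hA, aNorm_eq_norm_sqrt hA, inner_self_eq_norm_sq_to_K]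
  simp

theorem aInner_conj {A : H →L[ℂ] H} (hA : A.IsPositive) (x y : H) :
    (starRingEnd ℂ) (aInner A x y) = aInner A y x := by
  rw [aInner_eq_inner_sqrt hA, aInner_eq_inner_sqrt hA, inner_conj_symm]

/-- Every operator with an `A`-adjoint is bounded on the `A`-unit sphere. -/
theorem exists_bound {A T : H →L[ℂ] H} (hA : A.IsPositive) (hT : T ∈ BA A) :
    ∃ C : ℝ, ∀ x : H, aNorm A x = 1 → aNorm A (T x) ≤ C := by
  obtain ⟨W, hW⟩ := hT
  set B : H →L[ℂ] H := W * T with hB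
  have hBs : ∀ x y, aInner A (B x) y = aInner A x (B y) := by
    intro x y
    have h1 : aInner A x (B y) = aInner A (T x) (T y) := (hW x (T y)).symm
    have h2 : aInner A y (B x) = aInner A (T y) (T x) := (hW y (T x)).symm
    rw [← aInner_conj hA, h2, aInner_conj hA, h1]
  have hBk : ∀ (k : ℕ) (x y : H), aInner A ((B ^ k) x) y = aInner A x ((B ^ k) y) := by
    intro k
    induction k with
    | zero => intro x y; rfl
    | succ k ih =>
      intro x y
      rw [pow_succ]
      change aInner A ((B ^ k) (B x)) y = aInner A x ((B ^ k * B) y)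
      rw [ih, hBs, ← pow_succ, pow_succ']
      rfl
  have hnn : ∀ x, 0 ≤ aNorm A x := fun x => Real.sqrt_nonneg _
  have hM : 0 < ‖B‖ + 1 := by positivity
  have key : ∀ x : H, aNorm A x = 1 → aNorm A (B x) ≤ ‖B‖ + 1 := by
    intro x hx
    have step : ∀ n : ℕ, aNorm A (B x) ^ (2 ^ n) ≤ aNorm A ((B ^ (2 ^ n)) x) := by
      intro n
      induction n with
      | zero => simp
      | succ n ih =>
        have h1 : aNorm A ((B ^ (2 ^ n)) x) ^ 2 ≤ aNorm A ((B ^ (2 ^ (n + 1))) x) := by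
          rw [aNorm_sq hA, hBk]
          have h2 : (B ^ (2 ^ n)) ((B ^ (2 ^ n)) x) = (B ^ (2 ^ (n + 1))) x := by
            rw [pow_succ 2 n, mul_two, pow_add]; rfl
          rw [h2]
          have h3 := norm_aInner_le hA x ((B ^ (2 ^ (n + 1))) x)
          rwa [hx, one_mul] at h3
        calc aNorm A (B x) ^ (2 ^ (n + 1)) = (aNorm A (B x) ^ (2 ^ n)) ^ 2 := by
              rw [← pow_mul, pow_succ 2 n]
          _ ≤ aNorm A ((B ^ (2 ^ n)) x) ^ 2 :=
              pow_le_pow_left₀ (pow_nonneg (hnn _) _) ih 2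
          _ ≤ _ := h1
    have bound : ∀ n : ℕ, aNorm A ((B ^ n) x) ≤
        (‖CFC.sqrt A‖ * ‖x‖) * (‖B‖ + 1) ^ n := by
      intro n
      rw [aNorm_eq_norm_sqrt hA]
      have hpow : ‖(B ^ n) x‖ ≤ (‖B‖ + 1) ^ n * ‖x‖ := by
        induction n with
        | zero => simp
        | succ n ih =>
          rw [pow_succ']
          change ‖B ((B ^ n) x)‖ ≤ _
          calc ‖B ((B ^ n) x)‖ ≤ ‖B‖ * ‖(B ^ n) x‖ := B.le_opNorm _
            _ ≤ (‖B‖ + 1) * ((‖B‖ + 1) ^ n * ‖x‖) := by gcongr; linarith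
            _ = _ := by ring
      calc _ ≤ ‖CFC.sqrt A‖ * ‖(B ^ n) x‖ := (CFC.sqrt A).le_opNorm _
        _ ≤ ‖CFC.sqrt A‖ * ((‖B‖ + 1) ^ n * ‖x‖) := by gcongr
        _ = _ := by ring
    by_contra hlt
    have hq : 1 < aNorm A (B x) / (‖B‖ + 1) := by
      rw [one_lt_div hM]; exact not_le.1 hlt
    obtain ⟨n, hn⟩ := pow_unbounded_of_one_lt (‖CFC.sqrt A‖ * ‖x‖) hq
    have h1 : (aNorm A (B x) / (‖B‖ + 1)) ^ n ≤ (aNorm A (B x) / (‖B‖ + 1)) ^ (2 ^ n) :=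
      pow_le_pow_right₀ hq.le (Nat.lt_two_pow_self).le
    have h2 : (aNorm A (B x) / (‖B‖ + 1)) ^ (2 ^ n) ≤ ‖CFC.sqrt A‖ * ‖x‖ := by
      rw [div_pow, div_le_iff₀ (pow_pos hM _)]
      exact (step n).trans (bound _)
    linarith
  refine ⟨‖B‖ + 1, fun x hx => ?_⟩
  have h1 : aNorm A (T x) ^ 2 ≤ ‖B‖ + 1 := by
    rw [aNorm_sq hA, hW]
    have h2 := norm_aInner_le hA x (B x)
    rw [hx, one_mul] at h2
    exact h2.trans (key x hx)
  have hb := norm_nonneg B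
  by_contra hlt
  push Not at hlt
  nlinarith

/-- The supremum defining `‖T‖_A` is finite for `T` in `B_A(H)`. -/
theorem bddAbove_opANorm {A T : H →L[ℂ] H} (hA : A.IsPositive) (hT : T ∈ BA A) :
    BddAbove {r : ℝ | ∃ x : H, aNorm A x = 1 ∧ r = aNorm A (T x)} := by
  obtain ⟨C, hC⟩ := exists_bound hA hT
  refine ⟨C, ?_⟩
  rintro r ⟨x, hx, rfl⟩
  exact hC x hx

/-- The supremum defining `ω_A(T)` is finite for `T` in `B_A(H)`. -/
theorem bddAbove_aNumericalRadius {A T : H →L[ℂ] H} (hA : A.IsPositive) (hT : T ∈ BA A) :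
    BddAbove {r : ℝ | ∃ x : H, aNorm A x = 1 ∧ r = ‖aInner A (T x) x‖} := by
  obtain ⟨C, hC⟩ := exists_bound hA hT
  refine ⟨C, ?_⟩
  rintro r ⟨x, hx, rfl⟩
  have h := norm_aInner_le hA (T x) x
  rw [hx, mul_one] at h
  exact h.trans (hC x hx)

end Complete

end SemiHilbert

/-! Regard `H` as a seminormed space with the form `⟨·,·⟩_A`, in which an `A`-adjoint is an ordinary
adjoint. After a rotation, the numerical radius `v` of `T S` is almost attained as a real part at a
unit vector `x`, so `x` is an approximate eigenvector of `M = T S + S' T'` for `2v`. Now `M` is the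
row `(T, S')` times the column `(S, T')`. The product in the other order is a 2×2 block operator
with approximate eigenvector `(S x, T' x)` for the same `2v`, so `2v` is at most a bound for its
numerical radius. Its diagonal contributes `ω(S T)`. Its off-diagonal part contributes half the norm
of `S S' + T' T`, at most `(c² + ‖T S‖) / 2` if `‖T‖, ‖S‖ ≤ c` (`norm_sq_add_norm_sq_le`,
`re_inner_block_le`). Rescaling the factors gives `c² = ‖T‖ ‖S‖`. -/

namespace SemiHilbert

/-! ### The inequality for adjointable operators on a seminormed inner product space. -/

section SeminormedSpace

open scoped InnerProductSpace

variable {E : Type*} [SeminormedAddCommGroup E] [InnerProductSpace ℂ E]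

/-- A symmetric operator whose numerical radius is at most `l` is bounded by `l`. -/
theorem norm_apply_le_of_symmetric {M : E →ₗ[ℂ] E} (hM : ∀ x y, ⟪M x, y⟫_ℂ = ⟪x, M y⟫_ℂ)
    {l : ℝ} (hl : 0 < l) (h : ∀ x, |(⟪M x, x⟫_ℂ).re| ≤ l * ‖x‖ ^ 2) (x : E) :
    ‖M x‖ ≤ l * ‖x‖ := by
  have polar : ∀ y, 4 * (⟪M x, y⟫_ℂ).re ≤ l * (2 * ‖x‖ ^ 2 + 2 * ‖y‖ ^ 2) := by
    intro y
    have h1 := le_of_abs_le (h (x + y))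
    have h2 := neg_le_of_abs_le (h (x - y))
    have hp := parallelogram_law_with_norm ℂ x y
    have hs : (⟪M y, x⟫_ℂ).re = (⟪M x, y⟫_ℂ).re := by
      rw [hM y x, ← inner_conj_symm, Complex.conj_re]
    simp only [map_add, map_sub, inner_add_left, inner_add_right, inner_sub_left, inner_sub_right,
      Complex.add_re, Complex.sub_re, hs] at h1 h2
    have e : l * (2 * ‖x‖ ^ 2 + 2 * ‖y‖ ^ 2) = l * ‖x + y‖ ^ 2 + l * ‖x - y‖ ^ 2 := by
      linear_combination (-l) * hp
    rw [e]
    linarith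
  -- This choice of `y` avoids normalising `x` or `M x`, whose seminorms may vanish.
  have h1 := polar (((l⁻¹ : ℝ) : ℂ) • M x)
  have h2 : (⟪M x, M x⟫_ℂ).re = ‖M x‖ ^ 2 := inner_self_eq_norm_sq (𝕜 := ℂ) (M x)
  rw [inner_smul_right, Complex.re_ofReal_mul, h2, norm_smul, Complex.norm_real, Real.norm_eq_abs,
    mul_pow, sq_abs] at h1
  have h3 : ‖M x‖ ^ 2 ≤ (l * ‖x‖) ^ 2 := by
    have := mul_le_mul_of_nonneg_left h1 hl.le
    have e1 : l * (4 * (l⁻¹ * ‖M x‖ ^ 2)) = 4 * ‖M x‖ ^ 2 := by field_simp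
    have e2 : l * (l * (2 * ‖x‖ ^ 2 + 2 * (l⁻¹ ^ 2 * ‖M x‖ ^ 2))) =
      2 * (l * ‖x‖) ^ 2 + 2 * ‖M x‖ ^ 2 := by field_simp
    linarith
  exact le_of_sq_le_sq h3 (by positivity)

theorem norm_adjoint_apply_le {T T' : E →ₗ[ℂ] E} (hT : ∀ x y, ⟪T x, y⟫_ℂ = ⟪x, T' y⟫_ℂ)
    {c : ℝ} (hc : 0 ≤ c) (h : ∀ x, ‖T x‖ ≤ c * ‖x‖) (x : E) : ‖T' x‖ ≤ c * ‖x‖ := by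
  have h1 : ‖T' x‖ ^ 2 ≤ c * ‖x‖ * ‖T' x‖ := by
    calc ‖T' x‖ ^ 2 = (⟪T (T' x), x⟫_ℂ).re := by
          rw [hT]; exact (inner_self_eq_norm_sq (𝕜 := ℂ) (T' x)).symm
      _ ≤ ‖T (T' x)‖ * ‖x‖ := re_inner_le_norm (𝕜 := ℂ) _ _
      _ ≤ c * ‖T' x‖ * ‖x‖ := by gcongr; exact h _
      _ = c * ‖x‖ * ‖T' x‖ := by ring
  rcases (norm_nonneg (T' x)).eq_or_lt with h0 | h0
  · rw [← h0]; positivity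
  · exact le_of_mul_le_mul_right (by rwa [sq] at h1) h0

/-- `‖S S' + T' T‖ ≤ c² + ‖T S‖` in quadratic-form terms, when `‖T‖, ‖S‖ ≤ c`. -/
theorem norm_sq_add_norm_sq_le {T T' S S' : E →ₗ[ℂ] E}
    (hT : ∀ x y, ⟪T x, y⟫_ℂ = ⟪x, T' y⟫_ℂ) (hS : ∀ x y, ⟪S x, y⟫_ℂ = ⟪x, S' y⟫_ℂ)
    {c p : ℝ} (hc : 0 ≤ c) (hp : 0 ≤ p) (hTc : ∀ x, ‖T x‖ ≤ c * ‖x‖)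
    (hSc : ∀ x, ‖S x‖ ≤ c * ‖x‖) (hTS : ∀ x, ‖T (S x)‖ ≤ p * ‖x‖) (u : E) :
    ‖S' u‖ ^ 2 + ‖T u‖ ^ 2 ≤ (c ^ 2 + p) * ‖u‖ ^ 2 := by
  set a := S' u
  set b := T u
  set q := ‖a‖ ^ 2 + ‖b‖ ^ 2
  have hq : 0 ≤ q := by positivity
  -- Here `S a + T' b = (S S' + T' T) u`. Moving `T'` across turns the cross term into `⟨T S a, b⟩`,
  -- which is where `p` enters.
  have h1 : ‖S a + T' b‖ ^ 2 ≤ (c ^ 2 + p) * q := by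
    have e : ‖S a + T' b‖ ^ 2 = ‖S a‖ ^ 2 + 2 * (⟪T (S a), b⟫_ℂ).re + ‖T' b‖ ^ 2 := by
      rw [hT]; exact norm_add_sq (𝕜 := ℂ) _ _
    have i1 : ‖S a‖ ^ 2 ≤ (c * ‖a‖) ^ 2 := by gcongr; exact hSc a
    have i2 : ‖T' b‖ ^ 2 ≤ (c * ‖b‖) ^ 2 := by gcongr; exact norm_adjoint_apply_le hT hc hTc b
    have i3 : (⟪T (S a), b⟫_ℂ).re ≤ p * ‖a‖ * ‖b‖ :=
      (re_inner_le_norm (𝕜 := ℂ) _ _).trans (by gcongr; exact hTS a)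
    have i4 : 0 ≤ p * (‖a‖ - ‖b‖) ^ 2 := by positivity
    simp only [q]
    nlinarith
  have h2 : q ≤ ‖S a + T' b‖ * ‖u‖ := by
    have e : q = (⟪S a + T' b, u⟫_ℂ).re := by
      have e1 : ‖a‖ ^ 2 = (⟪S a, u⟫_ℂ).re := by
        rw [hS]; exact (inner_self_eq_norm_sq (𝕜 := ℂ) a).symm
      have e2 : ‖b‖ ^ 2 = (⟪T' b, u⟫_ℂ).re := by
        rw [← inner_conj_symm, Complex.conj_re, ← hT]
        exact (inner_self_eq_norm_sq (𝕜 := ℂ) b).symm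
      rw [inner_add_left, Complex.add_re, ← e1, ← e2]
    rw [e]
    exact re_inner_le_norm (𝕜 := ℂ) _ _
  have h3 : q * q ≤ (c ^ 2 + p) * ‖u‖ ^ 2 * q := by
    calc q * q ≤ (‖S a + T' b‖ * ‖u‖) * (‖S a + T' b‖ * ‖u‖) := by gcongr
      _ = ‖S a + T' b‖ ^ 2 * ‖u‖ ^ 2 := by ring
      _ ≤ (c ^ 2 + p) * q * ‖u‖ ^ 2 := by gcongr
      _ = _ := by ring
  rcases hq.eq_or_lt with h0 | h0
  · rw [← h0]; positivity
  · exact le_of_mul_le_mul_right h3 h0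

/-- The numerical radius of the operator matrix with rows `(S T, S S')` and `(T' T, T' S')`. -/
theorem re_inner_block_le {T T' S S' : E →ₗ[ℂ] E}
    (hT : ∀ x y, ⟪T x, y⟫_ℂ = ⟪x, T' y⟫_ℂ) (hS : ∀ x y, ⟪S x, y⟫_ℂ = ⟪x, S' y⟫_ℂ)
    {c p w : ℝ} (hc : 0 ≤ c) (hp : 0 ≤ p) (hTc : ∀ x, ‖T x‖ ≤ c * ‖x‖)
    (hSc : ∀ x, ‖S x‖ ≤ c * ‖x‖) (hTS : ∀ x, ‖T (S x)‖ ≤ p * ‖x‖)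
    (hw : ∀ x, ‖⟪S (T x), x⟫_ℂ‖ ≤ w * ‖x‖ ^ 2) (x y : E) :
    (⟪S (T x + S' y), x⟫_ℂ).re + (⟪T' (T x + S' y), y⟫_ℂ).re ≤
      (w + (c ^ 2 + p) / 2) * (‖x‖ ^ 2 + ‖y‖ ^ 2) := by
  have hT' : ∀ x y, (⟪T' x, y⟫_ℂ).re = (⟪T y, x⟫_ℂ).re := fun x y => by
    rw [hT, ← inner_conj_symm, Complex.conj_re]
  have h1 : (⟪S (T x), x⟫_ℂ).re ≤ w * ‖x‖ ^ 2 := (Complex.re_le_norm _).trans (hw x)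
  have h2 : (⟪T' (S' y), y⟫_ℂ).re ≤ w * ‖y‖ ^ 2 := by
    rw [hT', ← inner_conj_symm, Complex.conj_re, ← Complex.conj_re, inner_conj_symm, ← hS]
    exact (Complex.re_le_norm _).trans (hw y)
  -- The bracket is `Re ⟨Q x, y⟩` with `Q = S S' + T' T` positive, so polarization bounds four times
  -- it by `⟨Q (x + y), x + y⟩`.
  have h3 : 4 * ((⟪S (S' y), x⟫_ℂ).re + (⟪T' (T x), y⟫_ℂ).re) ≤
      (c ^ 2 + p) * ‖x + y‖ ^ 2 := by
    refine le_trans ?_ (norm_sq_add_norm_sq_le hT hS hc hp hTc hSc hTS (x + y))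
    have e1 : ‖S' (x + y)‖ ^ 2 = ‖S' x‖ ^ 2 + 2 * (⟪S' x, S' y⟫_ℂ).re + ‖S' y‖ ^ 2 := by
      rw [map_add]; exact norm_add_sq (𝕜 := ℂ) _ _
    have e2 : ‖T (x + y)‖ ^ 2 = ‖T x‖ ^ 2 + 2 * (⟪T x, T y⟫_ℂ).re + ‖T y‖ ^ 2 := by
      rw [map_add]; exact norm_add_sq (𝕜 := ℂ) _ _
    have e3 : ‖S' x - S' y‖ ^ 2 = ‖S' x‖ ^ 2 - 2 * (⟪S' x, S' y⟫_ℂ).re + ‖S' y‖ ^ 2 :=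
      norm_sub_sq (𝕜 := ℂ) _ _
    have e4 : ‖T x - T y‖ ^ 2 = ‖T x‖ ^ 2 - 2 * (⟪T x, T y⟫_ℂ).re + ‖T y‖ ^ 2 :=
      norm_sub_sq (𝕜 := ℂ) _ _
    have e5 : (⟪S (S' y), x⟫_ℂ).re = (⟪S' x, S' y⟫_ℂ).re := by
      rw [hS, ← inner_conj_symm, Complex.conj_re]
    have e6 : (⟪T' (T x), y⟫_ℂ).re = (⟪T x, T y⟫_ℂ).re := by
      rw [hT', ← inner_conj_symm, Complex.conj_re]
    have := sq_nonneg ‖S' x - S' y‖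
    have := sq_nonneg ‖T x - T y‖
    rw [e1, e2, e5, e6]
    linarith
  have h4 : (c ^ 2 + p) * ‖x + y‖ ^ 2 ≤ (c ^ 2 + p) * (2 * (‖x‖ ^ 2 + ‖y‖ ^ 2)) := by
    gcongr
    have := parallelogram_law_with_norm ℂ x y
    have := sq_nonneg ‖x - y‖
    linarith
  simp only [map_add, inner_add_left, Complex.add_re]
  linarith

/-- If `x` almost attains the numerical radius `v` of `T S`, then it is an approximate eigenvector
of `T S + S' T'` for the eigenvalue `2 v`, and `(S x, T' x)` is one of the block operator. -/
theorem approx_numericalRadius_le {T T' S S' : E →ₗ[ℂ] E}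
    (hT : ∀ x y, ⟪T x, y⟫_ℂ = ⟪x, T' y⟫_ℂ) (hS : ∀ x y, ⟪S x, y⟫_ℂ = ⟪x, S' y⟫_ℂ)
    {c p w v ε : ℝ} (hc : 0 ≤ c) (hp : 0 ≤ p) (hv : 0 < v) (hTc : ∀ x, ‖T x‖ ≤ c * ‖x‖)
    (hSc : ∀ x, ‖S x‖ ≤ c * ‖x‖) (hTS : ∀ x, ‖T (S x)‖ ≤ p * ‖x‖)
    (hw : ∀ x, ‖⟪S (T x), x⟫_ℂ‖ ≤ w * ‖x‖ ^ 2) (hvb : ∀ x, ‖⟪T (S x), x⟫_ℂ‖ ≤ v * ‖x‖ ^ 2)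
    (hK : w + (c ^ 2 + p) / 2 ≤ 2 * v) {x : E} (hx : ‖x‖ = 1)
    (hxv : v - ε ≤ (⟪T (S x), x⟫_ℂ).re) :
    (2 * v - (w + (c ^ 2 + p) / 2)) * (2 * v - 2 * ε) ≤ 2 * c ^ 2 * √(8 * v * ε) := by
  have hadj : ∀ x y, ⟪S' (T' x), y⟫_ℂ = ⟪x, T (S y)⟫_ℂ := fun x y => by
    rw [← inner_conj_symm, ← hS, ← hT, inner_conj_symm]
  set M : E →ₗ[ℂ] E := T ∘ₗ S + S' ∘ₗ T'
  have hMapp : ∀ z, M z = T (S z) + S' (T' z) := fun z => rfl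
  have hMs : ∀ x y, ⟪M x, y⟫_ℂ = ⟪x, M y⟫_ℂ := fun x y => by
    rw [hMapp, hMapp, inner_add_left, inner_add_right, hadj, hT, hS, add_comm]
  have hMre : ∀ z, (⟪M z, z⟫_ℂ).re = 2 * (⟪T (S z), z⟫_ℂ).re := fun z => by
    have e : (⟪S' (T' z), z⟫_ℂ).re = (⟪T (S z), z⟫_ℂ).re := by
      rw [hadj, ← inner_conj_symm, Complex.conj_re]
    rw [hMapp, inner_add_left, Complex.add_re, e]
    ring
  have hMx : ‖M x‖ ≤ 2 * v := by
    have := norm_apply_le_of_symmetric hMs (l := 2 * v) (by linarith) (fun z => by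
      rw [hMre, abs_mul, abs_two, mul_assoc]
      gcongr
      exact (Complex.abs_re_le_norm _).trans (hvb z)) x
    rwa [hx, mul_one] at this
  set d := M x - ((2 * v : ℝ) : ℂ) • x
  -- Expanding the square gives at most `4v² - 8v(v - ε) + 4v² = 8vε`.
  have hd : ‖d‖ ≤ √(8 * v * ε) := by
    apply Real.le_sqrt_of_sq_le
    have e : ‖d‖ ^ 2 = ‖M x‖ ^ 2 - 2 * (2 * v * (⟪M x, x⟫_ℂ).re) + (2 * v) ^ 2 := by
      have := norm_sub_sq (𝕜 := ℂ) (M x) (((2 * v : ℝ) : ℂ) • x)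
      rw [inner_smul_right, norm_smul, Complex.norm_real, hx, Real.norm_eq_abs, mul_one,
        sq_abs] at this
      rw [← Complex.re_ofReal_mul]
      exact this
    have h2 : ‖M x‖ ^ 2 ≤ (2 * v) ^ 2 := by gcongr
    have h3 : v * (v - ε) ≤ v * (⟪T (S x), x⟫_ℂ).re := by gcongr
    rw [e, hMre]
    linarith
  have hT'c : ∀ z, ‖T' z‖ ≤ c * ‖z‖ := norm_adjoint_apply_le hT hc hTc
  set Y := ‖S x‖ ^ 2 + ‖T' x‖ ^ 2
  -- This keeps the approximate eigenvector `(S x, T' x)` away from zero as `ε → 0`.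
  have hY : 2 * v - 2 * ε ≤ Y := by
    have h1 : (⟪T (S x), x⟫_ℂ).re ≤ ‖S x‖ * ‖T' x‖ := by
      rw [hT]; exact re_inner_le_norm (𝕜 := ℂ) _ _
    have := sq_nonneg (‖S x‖ - ‖T' x‖)
    simp only [Y]
    linarith
  have hMd : M x = ((2 * v : ℝ) : ℂ) • x + d := by simp [d]
  have hblock := re_inner_block_le hT hS hc hp hTc hSc hTS hw (S x) (T' x)
  rw [← hMapp, hMd] at hblock
  simp only [map_add, map_smul, inner_add_left, inner_smul_left, Complex.conj_ofReal,
    Complex.add_re, Complex.re_ofReal_mul] at hblock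
  have n1 : (⟪S x, S x⟫_ℂ).re = ‖S x‖ ^ 2 := inner_self_eq_norm_sq (𝕜 := ℂ) _
  have n2 : (⟪T' x, T' x⟫_ℂ).re = ‖T' x‖ ^ 2 := inner_self_eq_norm_sq (𝕜 := ℂ) _
  have err : ∀ R : E →ₗ[ℂ] E, (∀ z, ‖R z‖ ≤ c * ‖z‖) → -(c ^ 2 * ‖d‖) ≤ (⟪R d, R x⟫_ℂ).re := by
    intro R hR
    have h1 : |(⟪R d, R x⟫_ℂ).re| ≤ (c * ‖d‖) * (c * ‖x‖) :=
      (Complex.abs_re_le_norm _).trans ((norm_inner_le_norm _ _).trans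
        (mul_le_mul (hR d) (hR x) (norm_nonneg _) (by positivity)))
    have h2 := neg_le_of_abs_le h1
    rw [hx] at h2
    linarith
  have e1 := err S hSc
  have e2 := err T' hT'c
  rw [n1, n2] at hblock
  have h5 : (2 * v - (w + (c ^ 2 + p) / 2)) * Y ≤ 2 * c ^ 2 * ‖d‖ := by
    simp only [Y] at *
    linarith
  calc _ ≤ (2 * v - (w + (c ^ 2 + p) / 2)) * Y := by gcongr
    _ ≤ 2 * c ^ 2 * ‖d‖ := h5
    _ ≤ _ := by gcongr

/-- The numerical radius inequality for products of operators with a common bound `c`. -/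
theorem two_mul_numericalRadius_le_of_common_bound {T T' S S' : E →ₗ[ℂ] E}
    (hT : ∀ x y, ⟪T x, y⟫_ℂ = ⟪x, T' y⟫_ℂ) (hS : ∀ x y, ⟪S x, y⟫_ℂ = ⟪x, S' y⟫_ℂ)
    {c p w v : ℝ} (hc : 0 ≤ c) (hp : 0 ≤ p) (hv : 0 < v) (hTc : ∀ x, ‖T x‖ ≤ c * ‖x‖)
    (hSc : ∀ x, ‖S x‖ ≤ c * ‖x‖) (hTS : ∀ x, ‖T (S x)‖ ≤ p * ‖x‖)
    (hw : ∀ x, ‖⟪S (T x), x⟫_ℂ‖ ≤ w * ‖x‖ ^ 2) (hvb : ∀ x, ‖⟪T (S x), x⟫_ℂ‖ ≤ v * ‖x‖ ^ 2)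
    (hvs : ∀ ε > 0, ∃ x, ‖x‖ = 1 ∧ v - ε ≤ ‖⟪T (S x), x⟫_ℂ‖) :
    2 * v ≤ w + (c ^ 2 + p) / 2 := by
  by_contra! hK
  have key : ∀ ε > 0,
      (2 * v - (w + (c ^ 2 + p) / 2)) * (2 * v - 2 * ε) ≤ 2 * c ^ 2 * √(8 * v * ε) := by
    intro ε hε
    obtain ⟨x, hx, hxv⟩ := hvs ε hε
    obtain ⟨a, ha, hax⟩ : ∃ a : ℂ, ‖a‖ = 1 ∧ a * ⟪T (S x), x⟫_ℂ = ‖⟪T (S x), x⟫_ℂ‖ := by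
      obtain ⟨a, ha, h⟩ := RCLike.exists_norm_eq_mul_self (⟪T (S x), x⟫_ℂ)
      exact ⟨a, ha, h.symm⟩
    -- The rotation multiplies `T` by the conjugate of `a`, since the inner product is
    -- conjugate-linear in its first argument.
    have hna : ‖(starRingEnd ℂ) a‖ = 1 := by rw [RCLike.norm_conj, ha]
    refine approx_numericalRadius_le (T := (starRingEnd ℂ) a • T) (T' := a • T') (S := S)
      (S' := S') (fun x y => ?_) hS hc hp hv (fun x => ?_) hSc (fun x => ?_) (fun x => ?_)
      (fun x => ?_) hK.le hx ?_
    · simp only [LinearMap.smul_apply, inner_smul_left, inner_smul_right, Complex.conj_conj, hT]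
    · simpa [norm_smul, ha] using hTc x
    · simpa [norm_smul, ha] using hTS x
    · simpa [inner_smul_left, ha] using hw x
    · simpa [inner_smul_left, ha] using hvb x
    · rw [LinearMap.smul_apply, inner_smul_left, Complex.conj_conj, hax, Complex.ofReal_re]
      exact hxv
  -- As `ε → 0` the right side of `key` vanishes, while the left tends to a positive number.
  have lim1 : Filter.Tendsto (fun ε : ℝ => (2 * v - (w + (c ^ 2 + p) / 2)) * (2 * v - 2 * ε))
      (nhdsWithin 0 (Set.Ioi 0)) (nhds ((2 * v - (w + (c ^ 2 + p) / 2)) * (2 * v - 2 * 0))) :=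
    (Continuous.tendsto (by fun_prop) 0).mono_left nhdsWithin_le_nhds
  have lim2 : Filter.Tendsto (fun ε : ℝ => 2 * c ^ 2 * √(8 * v * ε))
      (nhdsWithin 0 (Set.Ioi 0)) (nhds (2 * c ^ 2 * √(8 * v * 0))) :=
    (Continuous.tendsto (by fun_prop) 0).mono_left nhdsWithin_le_nhds
  have h := le_of_tendsto_of_tendsto lim1 lim2
    (Filter.eventually_of_mem self_mem_nhdsWithin key)
  have hpos : 0 < (2 * v - (w + (c ^ 2 + p) / 2)) * (2 * v) := mul_pos (by linarith) (by linarith)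
  simp only [mul_zero, sub_zero, Real.sqrt_zero] at h
  linarith

/-- Replacing `T, S` by `r T, r⁻¹ S` changes neither `T S` nor `S T`; `r = √s / √t` makes both norm
bounds equal to `√t √s`. -/
theorem two_mul_numericalRadius_le {T T' S S' : E →ₗ[ℂ] E}
    (hT : ∀ x y, ⟪T x, y⟫_ℂ = ⟪x, T' y⟫_ℂ) (hS : ∀ x y, ⟪S x, y⟫_ℂ = ⟪x, S' y⟫_ℂ)
    {t s p w v : ℝ} (ht : 0 ≤ t) (hs : 0 ≤ s) (hp : 0 ≤ p) (hv : 0 < v)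
    (hTt : ∀ x, ‖T x‖ ≤ t * ‖x‖) (hSs : ∀ x, ‖S x‖ ≤ s * ‖x‖) (hTS : ∀ x, ‖T (S x)‖ ≤ p * ‖x‖)
    (hw : ∀ x, ‖⟪S (T x), x⟫_ℂ‖ ≤ w * ‖x‖ ^ 2) (hvb : ∀ x, ‖⟪T (S x), x⟫_ℂ‖ ≤ v * ‖x‖ ^ 2)
    (hvs : ∀ ε > 0, ∃ x, ‖x‖ = 1 ∧ v - ε ≤ ‖⟪T (S x), x⟫_ℂ‖) :
    2 * v ≤ w + (t * s + p) / 2 := by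
  have hts : 0 < t * s := by
    obtain ⟨x, hx, hxv⟩ := hvs (v / 2) (by linarith)
    have h1 : ‖⟪T (S x), x⟫_ℂ‖ ≤ t * (s * ‖x‖) * ‖x‖ :=
      (norm_inner_le_norm _ _).trans (by gcongr; exact (hTt _).trans (by gcongr; exact hSs x))
    rw [hx] at h1
    linarith
  have ht0 : 0 < t := pos_of_mul_pos_left hts hs
  have hs0 : 0 < s := pos_of_mul_pos_right hts ht
  have hst : 0 < √s := Real.sqrt_pos.2 hs0
  have htt : 0 < √t := Real.sqrt_pos.2 ht0
  set r : ℝ := √s / √t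
  have hr : 0 < r := div_pos hst htt
  have hr0 : (r : ℂ) ≠ 0 := by exact_mod_cast hr.ne'
  have hc2 : (√t * √s) ^ 2 = t * s := by rw [mul_pow, Real.sq_sqrt ht, Real.sq_sqrt hs]
  have e1 : r * t = √t * √s := by
    have : t = √t * √t := (Real.mul_self_sqrt ht).symm
    simp only [r]
    rw [div_mul_eq_mul_div, div_eq_iff htt.ne']
    linear_combination √s * this
  have e2 : r⁻¹ * s = √t * √s := by
    have : s = √s * √s := (Real.mul_self_sqrt hs).symm
    simp only [r]
    rw [inv_div, div_mul_eq_mul_div, div_eq_iff hst.ne']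
    linear_combination √t * this
  have f1 : ∀ x, ((r : ℂ) • T) (((r : ℂ)⁻¹ • S) x) = T (S x) := fun x => by
    simp only [LinearMap.smul_apply, map_smul, smul_smul, inv_mul_cancel₀ hr0, one_smul]
  have f2 : ∀ x, ((r : ℂ)⁻¹ • S) (((r : ℂ) • T) x) = S (T x) := fun x => by
    simp only [LinearMap.smul_apply, map_smul, smul_smul, mul_inv_cancel₀ hr0, one_smul]
  rw [← hc2]
  refine two_mul_numericalRadius_le_of_common_bound (T := (r : ℂ) • T) (T' := (r : ℂ) • T')
    (S := (r : ℂ)⁻¹ • S) (S' := (r : ℂ)⁻¹ • S') (fun x y => ?_) (fun x y => ?_) (by positivity) hp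
    hv (fun x => ?_) (fun x => ?_) (fun x => ?_) (fun x => ?_) (fun x => ?_) (fun ε hε => ?_)
  · simp only [LinearMap.smul_apply, inner_smul_left, inner_smul_right, Complex.conj_ofReal, hT]
  · simp only [LinearMap.smul_apply, inner_smul_left, inner_smul_right, map_inv₀,
      Complex.conj_ofReal, hS]
  · rw [LinearMap.smul_apply, norm_smul, Complex.norm_real, Real.norm_of_nonneg hr.le, ← e1,
      mul_assoc]
    gcongr
    exact hTt x
  · rw [LinearMap.smul_apply, norm_smul, norm_inv, Complex.norm_real, Real.norm_of_nonneg hr.le,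
      ← e2, mul_assoc]
    gcongr
    exact hSs x
  · rw [f1]; exact hTS x
  · rw [f2]; exact hw x
  · rw [f1]; exact hvb x
  · simp only [f1]; exact hvs ε hε

end SeminormedSpace

/-! ### Transfer to the semi-inner product of `A`. -/

section SemiHilbert

variable {H : Type*} [NormedAddCommGroup H] [InnerProductSpace ℂ H]

theorem aNorm_nonneg (A : H →L[ℂ] H) (x : H) : 0 ≤ aNorm A x := Real.sqrt_nonneg _

theorem aInner_smul_smul (A : H →L[ℂ] H) (a : ℂ) (x y : H) :
    ‖aInner A (a • x) (a • y)‖ = ‖a‖ ^ 2 * ‖aInner A x y‖ := by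
  simp only [aInner, map_smul, inner_smul_left, inner_smul_right, norm_mul, RCLike.norm_conj]
  ring

theorem opANorm_nonneg (A T : H →L[ℂ] H) : 0 ≤ opANorm A T :=
  Real.sSup_nonneg (by rintro r ⟨x, -, rfl⟩; exact aNorm_nonneg _ _)

theorem aNumericalRadius_nonneg (A T : H →L[ℂ] H) : 0 ≤ aNumericalRadius A T :=
  Real.sSup_nonneg (by rintro r ⟨x, -, rfl⟩; exact norm_nonneg _)

variable [CompleteSpace H]

/-- The semi-inner product `⟨x, y⟩_A` as a pre-inner product space structure. -/
@[reducible]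
noncomputable def aInnerCore {A : H →L[ℂ] H} (hA : A.IsPositive) :
    PreInnerProductSpace.Core ℂ H where
  inner := aInner A
  conj_inner_symm x y := aInner_conj hA y x
  re_inner_nonneg x := by
    rw [aInner_eq_inner_sqrt hA]; exact inner_self_nonneg
  add_left x y z := by simp only [aInner, map_add, inner_add_left]
  smul_left x y r := by simp only [aInner, map_smul, inner_smul_left]

theorem aNorm_smul {A : H →L[ℂ] H} (hA : A.IsPositive) (a : ℂ) (x : H) :
    aNorm A (a • x) = ‖a‖ * aNorm A x := by
  rw [aNorm_eq_norm_sqrt hA, aNorm_eq_norm_sqrt hA, map_smul, norm_smul]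

theorem aNorm_inv_smul {A : H →L[ℂ] H} (hA : A.IsPositive) {x : H} (hx : aNorm A x ≠ 0) :
    aNorm A (((aNorm A x)⁻¹ : ℂ) • x) = 1 := by
  rw [aNorm_smul hA, norm_inv, Complex.norm_real, Real.norm_of_nonneg (aNorm_nonneg A x),
    inv_mul_cancel₀ hx]

/-- The supremum does not see vectors of `A`-seminorm zero; there the `A`-adjoint `W` and
Cauchy–Schwarz for `⟨x, W T x⟩_A` force `‖T x‖_A = 0`. -/
theorem aNorm_apply_le {A T : H →L[ℂ] H} (hA : A.IsPositive) (hT : T ∈ BA A) (x : H) :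
    aNorm A (T x) ≤ opANorm A T * aNorm A x := by
  by_cases hx : aNorm A x = 0
  · obtain ⟨W, hW⟩ := hT
    have h : aNorm A (T x) ^ 2 ≤ 0 := by
      rw [aNorm_sq hA, hW]
      exact (norm_aInner_le hA _ _).trans (by rw [hx, zero_mul])
    have h0 : aNorm A (T x) = 0 := pow_eq_zero_iff two_ne_zero |>.1 (h.antisymm (sq_nonneg _))
    rw [h0, hx, mul_zero]
  · have hpos : 0 < aNorm A x := (aNorm_nonneg A x).lt_of_ne' hx
    have h := le_csSup (bddAbove_opANorm hA hT) ⟨_, aNorm_inv_smul hA hx, rfl⟩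
    rw [map_smul, aNorm_smul hA, norm_inv, Complex.norm_real, Real.norm_of_nonneg hpos.le,
      inv_mul_le_iff₀ hpos, mul_comm] at h
    exact h

theorem norm_aInner_apply_le {A T : H →L[ℂ] H} (hA : A.IsPositive) (hT : T ∈ BA A) (x : H) :
    ‖aInner A (T x) x‖ ≤ aNumericalRadius A T * aNorm A x ^ 2 := by
  by_cases hx : aNorm A x = 0
  · have h := norm_aInner_le hA (T x) x
    rw [hx, mul_zero] at h
    rwa [hx, zero_pow two_ne_zero, mul_zero]
  · have hpos : 0 < aNorm A x := (aNorm_nonneg A x).lt_of_ne' hx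
    have h := le_csSup (bddAbove_aNumericalRadius hA hT) ⟨_, aNorm_inv_smul hA hx, rfl⟩
    rw [map_smul, aInner_smul_smul, norm_inv, Complex.norm_real, Real.norm_of_nonneg hpos.le,
      inv_pow, inv_mul_le_iff₀ (pow_pos hpos 2), mul_comm] at h
    exact h

end SemiHilbert

end SemiHilbert

open SemiHilbert in
theorem theorem2p6 {H : Type*} [NormedAddCommGroup H] [InnerProductSpace ℂ H] [CompleteSpace H]
    (A : H →L[ℂ] H) (hA : A.IsPositive) (hA0 : A ≠ 0)
    (T S : H →L[ℂ] H) (hT : T ∈ SemiHilbert.BA A) (hS : S ∈ SemiHilbert.BA A) :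
    SemiHilbert.aNumericalRadius A (T ∘L S) ≤
      1 / 2 * SemiHilbert.aNumericalRadius A (S ∘L T) +
        1 / 4 * (SemiHilbert.opANorm A T * SemiHilbert.opANorm A S +
          SemiHilbert.opANorm A (T ∘L S)) := by
  have hTS : T ∘L S ∈ BA A := comp_mem_BA hT hS
  have hST : S ∘L T ∈ BA A := comp_mem_BA hS hT
  have hTn := opANorm_nonneg A T
  have hSn := opANorm_nonneg A S
  have hTSn := opANorm_nonneg A (T ∘L S)
  rcases (aNumericalRadius_nonneg A (T ∘L S)).eq_or_lt with hv | hv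
  · rw [← hv]
    have := aNumericalRadius_nonneg A (S ∘L T)
    positivity
  obtain ⟨T', hT'⟩ := id hT
  obtain ⟨S', hS'⟩ := id hS
  have hvs : ∀ ε > 0, ∃ x, aNorm A x = 1 ∧
      aNumericalRadius A (T ∘L S) - ε ≤ ‖aInner A (T (S x)) x‖ := by
    intro ε hε
    -- Since `sSup ∅ = 0` in the reals, a positive supremum provides a unit vector.
    have hne : {r : ℝ | ∃ x : H, aNorm A x = 1 ∧ r = ‖aInner A ((T ∘L S) x) x‖}.Nonempty := by
      by_contra h
      rw [Set.not_nonempty_iff_eq_empty] at h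
      rw [aNumericalRadius, h, Real.sSup_empty] at hv
      exact lt_irrefl _ hv
    obtain ⟨r, ⟨x, hx, rfl⟩, hr⟩ := exists_lt_of_lt_csSup hne (sub_lt_self _ hε)
    exact ⟨x, hx, hr.le⟩
  have key := @two_mul_numericalRadius_le H
    (@InnerProductSpace.Core.toSeminormedAddCommGroup ℂ H _ _ _ (aInnerCore hA))
    (InnerProductSpace.ofCore (aInnerCore hA)) T.toLinearMap T'.toLinearMap S.toLinearMap
    S'.toLinearMap hT' hS' _ _ _ _ _ hTn hSn hTSn hv (aNorm_apply_le hA hT) (aNorm_apply_le hA hS)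
    (aNorm_apply_le hA hTS) (norm_aInner_apply_le hA hST) (norm_aInner_apply_le hA hTS) hvs
  linarith
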